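/- **Proposition 5.4.** Let $p$ be an odd prime and let $R=\widehat{\mathbb Z_p^{ur}}=W(\overline{\mathbb F}_p)$ be the $p$-adic completion of the maximal unramified extension of $\mathbb Z_p$, with $\phi:R\to R$ the automorphism lifting the $p$-power Frobenius of the residue field; $\widehat{\ }$ denotes $p$-adic completion. Let $R\{x\}=R[x,x',x'',\dots]$ be the polynomial ring in the variables $x=x^{(0)},x'=x^{(1)},x''=x^{(2)},\dots$, let $\phi$ be extended to a ring endomorphism of $R\{x\}$ by $\phi(x^{(i)})=(x^{(i)})^p+p\,x^{(i+1)}$, and let $\delta f=(\phi(f)-f^p)/p$ be the corresponding $p$-derivation of $R\{x\}$, so that $\delta x^{(i)}=x^{(i+1)}$. For $n\ge 0$ and $f\in R[x]$, the ring of functions on the $p$-jet space $J^n(X)$ of $X=\mathrm{Spec}\,R[x]/(f)$ is $$\mathcal O^n(X)=R[x,x',\dots,x^{(n)}]\widehat{\ }/(f,\delta f,\dots,\delta^n f).$$ For $\nu\ge 1$ let $\mu_{p^\nu}=\mathrm{Spec}\,R[x]/(x^{p^\nu}-1)$, and let $\mathcal O^n(\mu_{p^\nu})_1$ be the ring of functions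 on the kernel $J^n(\mu_{p^\nu})_1$ of the projection $J^n(\mu_{p^\nu})\to J^0(\mu_{p^\nu})=\widehat{\mu_{p^\nu}}$, that is, on the preimage of the unit section: the quotient of $\mathcal O^n(\mu_{p^\nu})$ by the ideal generated by the image of the kernel of the counit $R[x]/(x^{p^\nu}-1)\to R$, $x\mapsto 1$. The inclusions $\mu_{p^\nu}\subset\mu_{p^{\nu+1}}$ make $(\mathcal O^n(\mu_{p^\nu})_1)_{\nu\ge1}$ an inverse system of $R$-algebras. Then, for every $n\ge 1$, the $R$-algebra homomorphisms $R[x',\dots,x^{(n)}]\widehat{\ }\to\mathcal O^n(\mu_{p^\nu})_1$ induced by the inclusion $R[x',\dots,x^{(n)}]\subset R[x,x',\dots,x^{(n)}]$ induce an isomorphism of $R$-algebras $$R[x',\dots,x^{(n)}]\widehat{\ }\;\stackrel{\sim}{\longrightarrow}\;\lim_{\stackrel{\longleftarrow}{\nu\ge 1}}\mathcal O^n(\mu_{p^\nu})_1 .$$ -/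

import Mathlib

open scoped Polynomial

noncomputable section

namespace PJet

/-- The base ring `R`, i.e. the `p`-adic completion of the maximal unramified extension of `ℤ_p`,
realised as the ring of `p`-typical Witt vectors of an algebraic closure of `𝔽_p`. The ring
automorphism lifting the `p`-power Frobenius of the residue field is `WittVector.frobenius`. -/
abbrev BaseRing (p : ℕ) [Fact p.Prime] : Type :=
  WittVector p (AlgebraicClosure (ZMod p))

/-- The underlying ring `R[x, x', x'', …]` of the ring `R{x}` of `δ`-polynomials in one variable;
the variable `X i` is `x^{(i)}`. -/
abbrev DeltaPoly (p : ℕ) [Fact p.Prime] : Type :=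
  MvPolynomial ℕ (BaseRing p)

/-- The lift of Frobenius `φ(f) = f^p + p δ f` on `R{x}`: it is the Frobenius automorphism on `R`
and it sends `x^{(i)}` to `(x^{(i)})^p + p x^{(i+1)}`. -/
def phi (p : ℕ) [Fact p.Prime] : DeltaPoly p →+* DeltaPoly p :=
  MvPolynomial.eval₂Hom (MvPolynomial.C.comp WittVector.frobenius)
    (fun i => MvPolynomial.X i ^ p + (p : DeltaPoly p) * MvPolynomial.X (i + 1))

theorem base_frobenius_dvd (p : ℕ) [Fact p.Prime] (a : BaseRing p) :
    (p : BaseRing p) ∣ WittVector.frobenius a - a ^ p := by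
  rw [← Ideal.mem_span_singleton, ← WittVector.ker_constantCoeff, RingHom.mem_ker, map_sub,
    map_pow, sub_eq_zero]
  exact WittVector.coeff_frobenius_charP p a 0

theorem phi_sub_pow_dvd (p : ℕ) [Fact p.Prime] (f : DeltaPoly p) :
    (p : DeltaPoly p) ∣ phi p f - f ^ p := by
  induction f using MvPolynomial.induction_on with
  | C a =>
    obtain ⟨b, hb⟩ := base_frobenius_dvd p a
    refine ⟨MvPolynomial.C b, ?_⟩
    have h : phi p (MvPolynomial.C a) = MvPolynomial.C (WittVector.frobenius a) := by
      simp [phi]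
    rw [h, ← map_pow, ← map_sub, hb, map_mul, map_natCast]
  | add f g hf hg =>
    obtain ⟨r, hr⟩ := exists_add_pow_prime_eq (Fact.out : p.Prime) f g
    obtain ⟨a, ha⟩ := hf
    obtain ⟨b, hb⟩ := hg
    refine ⟨a + b - f * g * r, ?_⟩
    rw [map_add, hr]
    linear_combination ha + hb
  | mul_X f i hf =>
    obtain ⟨a, ha⟩ := hf
    refine ⟨a * MvPolynomial.X i ^ p + phi p f * MvPolynomial.X (i + 1), ?_⟩
    have h : phi p (MvPolynomial.X i)
        = MvPolynomial.X i ^ p + (p : DeltaPoly p) * MvPolynomial.X (i + 1) := by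
      simp [phi]
    rw [map_mul, h, mul_pow]
    linear_combination (MvPolynomial.X i ^ p) * ha

/-- The `p`-derivation `δ f = (φ(f) - f^p) / p` of `R{x}`. The quotient is unique because `R{x}`
is `p`-torsion free, see `p_mul_delta` and `eq_delta`. -/
def delta (p : ℕ) [Fact p.Prime] (f : DeltaPoly p) : DeltaPoly p :=
  (phi_sub_pow_dvd p f).choose

theorem p_mul_delta (p : ℕ) [Fact p.Prime] (f : DeltaPoly p) :
    (p : DeltaPoly p) * delta p f = phi p f - f ^ p :=
  (phi_sub_pow_dvd p f).choose_spec.symm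

theorem p_ne_zero_base (p : ℕ) [Fact p.Prime] : (p : BaseRing p) ≠ 0 := by
  intro h
  apply one_ne_zero (α := BaseRing p)
  apply WittVector.eq_zero_of_p_mul_eq_zero
  rw [h, mul_zero]

theorem p_ne_zero (p : ℕ) [Fact p.Prime] : (p : DeltaPoly p) ≠ 0 := by
  rw [← map_natCast (MvPolynomial.C : BaseRing p →+* DeltaPoly p),
    ← map_zero (MvPolynomial.C : BaseRing p →+* DeltaPoly p)]
  exact fun h => p_ne_zero_base p (MvPolynomial.C_injective _ _ h)

theorem eq_delta (p : ℕ) [Fact p.Prime] {f g : DeltaPoly p}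
    (h : (p : DeltaPoly p) * g = phi p f - f ^ p) : g = delta p f :=
  mul_left_cancel₀ (p_ne_zero p) (h.trans (p_mul_delta p f).symm)

theorem delta_X (p : ℕ) [Fact p.Prime] (i : ℕ) :
    delta p (MvPolynomial.X i) = MvPolynomial.X (i + 1) := by
  refine (eq_delta p ?_).symm
  simp [phi]

theorem delta_mul (p : ℕ) [Fact p.Prime] (f g : DeltaPoly p) :
    delta p (f * g) = f ^ p * delta p g + g ^ p * delta p f
      + (p : DeltaPoly p) * (delta p f * delta p g) := by
  refine (eq_delta p ?_).symm
  rw [map_mul, mul_pow]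
  linear_combination (f ^ p + p * delta p f) * p_mul_delta p g
    + phi p g * p_mul_delta p f

theorem delta_add (p : ℕ) [Fact p.Prime] (f g : DeltaPoly p) :
    ∃ r, delta p (f + g) = delta p f + delta p g - f * g * r := by
  obtain ⟨r, hr⟩ := exists_add_pow_prime_eq (Fact.out : p.Prime) f g
  refine ⟨r, (eq_delta p ?_).symm⟩
  rw [map_add, hr]
  linear_combination p_mul_delta p f + p_mul_delta p g

/-- The polynomial ring `R[x, x', …, x^{(n)}]`; the variable `X i` is `x^{(i)}`. -/
abbrev JetPoly (p : ℕ) [Fact p.Prime] (n : ℕ) : Type :=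
  MvPolynomial (Fin (n + 1)) (BaseRing p)

/-- The inclusion `R[x, x', …, x^{(n)}] ⊆ R{x}`. -/
abbrev incl (p : ℕ) [Fact p.Prime] (n : ℕ) : JetPoly p n →ₐ[BaseRing p] DeltaPoly p :=
  MvPolynomial.rename (fun i : Fin (n + 1) => (i : ℕ))

/-- The inclusion `R[x] ⊆ R{x}`. -/
abbrev polyIncl (p : ℕ) [Fact p.Prime] : (BaseRing p)[X] →ₐ[BaseRing p] DeltaPoly p :=
  Polynomial.aeval (MvPolynomial.X 0)

/-- The set `{f, δ f, …, δ^n f}`, viewed inside `R[x, x', …, x^{(n)}]`. That `δ^j f` does lie in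
this subring for `j ≤ n` is `exists_incl_eq`. -/
def jetEqs (p : ℕ) [Fact p.Prime] (f : (BaseRing p)[X]) (n : ℕ) : Set (JetPoly p n) :=
  {g | ∃ j ≤ n, incl p n g = (delta p)^[j] (polyIncl p f)}

theorem phi_vars (p : ℕ) [Fact p.Prime] (n : ℕ) (f : DeltaPoly p)
    (hf : f ∈ MvPolynomial.supported (BaseRing p) {i : ℕ | i < n}) :
    phi p f ∈ MvPolynomial.supported (BaseRing p) {i : ℕ | i < n + 1} := by
  induction hf using Algebra.adjoin_induction with
  | mem x hx =>
    obtain ⟨i, hi, rfl⟩ := hx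
    have hi' : i < n := hi
    have h : phi p (MvPolynomial.X i)
        = MvPolynomial.X i ^ p + (p : DeltaPoly p) * MvPolynomial.X (i + 1) := by
      simp [phi]
    rw [h]
    refine add_mem (pow_mem (MvPolynomial.X_mem_supported.2 ?_) _)
      (mul_mem (natCast_mem _ _) (MvPolynomial.X_mem_supported.2 ?_))
    · exact Nat.lt_succ_of_lt hi'
    · exact Nat.succ_lt_succ hi'
  | algebraMap r =>
    have h : phi p (algebraMap (BaseRing p) (DeltaPoly p) r)
        = algebraMap (BaseRing p) (DeltaPoly p) (WittVector.frobenius r) := by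
      simp [phi, MvPolynomial.algebraMap_eq]
    rw [h]
    exact Subalgebra.algebraMap_mem _ _
  | add x y _ _ hx hy => rw [map_add]; exact add_mem hx hy
  | mul x y _ _ hx hy => rw [map_mul]; exact mul_mem hx hy

theorem delta_vars (p : ℕ) [Fact p.Prime] (n : ℕ) (f : DeltaPoly p)
    (hf : f ∈ MvPolynomial.supported (BaseRing p) {i : ℕ | i < n}) :
    delta p f ∈ MvPolynomial.supported (BaseRing p) {i : ℕ | i < n + 1} := by
  have h1 : (p : DeltaPoly p) * delta p f
      ∈ MvPolynomial.supported (BaseRing p) {i : ℕ | i < n + 1} := by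
    rw [p_mul_delta]
    refine sub_mem (phi_vars p n f hf) (pow_mem (MvPolynomial.supported_mono ?_ hf) _)
    exact fun i hi => Nat.lt_succ_of_lt hi
  rw [MvPolynomial.mem_supported, ← map_natCast (MvPolynomial.C : BaseRing p →+* DeltaPoly p),
    MvPolynomial.vars_C_mul _ (p_ne_zero_base p)] at h1
  exact MvPolynomial.mem_supported.2 h1

theorem polyIncl_mem (p : ℕ) [Fact p.Prime] (f : (BaseRing p)[X]) :
    polyIncl p f ∈ MvPolynomial.supported (BaseRing p) {i : ℕ | i < 1} := by
  have h : polyIncl p f ∈ Algebra.adjoin (BaseRing p) {(MvPolynomial.X 0 : DeltaPoly p)} :=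
    Polynomial.aeval_mem_adjoin_singleton _ _
  refine Algebra.adjoin_le ?_ h
  rintro _ rfl
  exact MvPolynomial.X_mem_supported.2 Nat.zero_lt_one

theorem exists_incl_eq (p : ℕ) [Fact p.Prime] (f : (BaseRing p)[X]) {j n : ℕ} (hj : j ≤ n) :
    ∃ g, incl p n g = (delta p)^[j] (polyIncl p f) := by
  have h : (delta p)^[j] (polyIncl p f)
      ∈ MvPolynomial.supported (BaseRing p) {i : ℕ | i < j + 1} := by
    clear hj
    induction j with
    | zero => exact polyIncl_mem p f
    | succ j ih =>
      rw [Function.iterate_succ_apply']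
      exact delta_vars p _ _ ih
  apply MvPolynomial.exists_rename_eq_of_vars_subset_range _ _ Fin.val_injective
  intro i hi
  have : i < j + 1 := MvPolynomial.mem_supported.1 h hi
  exact ⟨⟨i, by lia⟩, rfl⟩

/-- If `h` is in the ideal `(f, δ f, …, δ^n f)` of `R{x}` then `δ h` is in
`(f, δ f, …, δ^{n+1} f)`. -/
theorem delta_mem_span (p : ℕ) [Fact p.Prime] (f : DeltaPoly p) (n : ℕ) (h : DeltaPoly p)
    (hh : h ∈ Ideal.span {g | ∃ j ≤ n, g = (delta p)^[j] f}) :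
    delta p h ∈ Ideal.span {g | ∃ j ≤ n + 1, g = (delta p)^[j] f} := by
  have hle : Ideal.span {g | ∃ j ≤ n, g = (delta p)^[j] f}
      ≤ Ideal.span {g | ∃ j ≤ n + 1, g = (delta p)^[j] f} := by
    refine Ideal.span_mono ?_
    rintro _ ⟨j, hj, rfl⟩
    exact ⟨j, by lia, rfl⟩
  induction hh using Submodule.span_induction with
  | mem x hx =>
    obtain ⟨j, hj, rfl⟩ := hx
    exact Ideal.subset_span ⟨j + 1, by lia, (Function.iterate_succ_apply' _ _ _).symm⟩
  | zero =>
    have h0 : delta p 0 = 0 :=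
      (eq_delta p (by simp [(Fact.out : p.Prime).ne_zero])).symm
    rw [h0]
    exact zero_mem _
  | add x y hx hy ihx ihy =>
    obtain ⟨r, hr⟩ := delta_add p x y
    rw [hr]
    exact sub_mem (add_mem ihx ihy)
      (Ideal.mul_mem_right _ _ (Ideal.mul_mem_right _ _ (hle hx)))
  | smul a x hx ihx =>
    rw [smul_eq_mul, delta_mul]
    refine add_mem (add_mem (Ideal.mul_mem_left _ _ ihx) (Ideal.mul_mem_right _ _ ?_))
      (Ideal.mul_mem_left _ _ (Ideal.mul_mem_left _ _ ihx))
    exact Ideal.pow_mem_of_mem _ (hle hx) _ (Fact.out : p.Prime).pos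

/-- If `f` divides `g`, the ideal `(g, δ g, …, δ^n g)` of `R[x, x', …, x^{(n)}]` is contained in
`(f, δ f, …, δ^n f)`. -/
theorem span_jetEqs_le (p : ℕ) [Fact p.Prime] {f g : (BaseRing p)[X]} (hfg : f ∣ g) (n : ℕ) :
    Ideal.span (jetEqs p g n) ≤ Ideal.span (jetEqs p f n) := by
  have key : ∀ j, (delta p)^[j] (polyIncl p g)
      ∈ Ideal.span {h | ∃ i ≤ j, h = (delta p)^[i] (polyIncl p f)} := by
    intro j
    induction j with
    | zero =>
      obtain ⟨q, rfl⟩ := hfg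
      rw [Function.iterate_zero, id_eq, map_mul]
      exact Ideal.mul_mem_right _ _ (Ideal.subset_span ⟨0, le_rfl, rfl⟩)
    | succ j ih =>
      rw [Function.iterate_succ_apply']
      exact delta_mem_span p _ _ _ ih
  let ρ : DeltaPoly p →ₐ[BaseRing p] JetPoly p n :=
    MvPolynomial.aeval (fun i => if h : i < n + 1 then MvPolynomial.X ⟨i, h⟩ else 0)
  have hρ : ∀ e, ρ (incl p n e) = e := by
    intro e
    have : ρ.comp (incl p n) = AlgHom.id _ _ := by
      apply MvPolynomial.algHom_ext
      intro i
      have h : ¬ n < (i : ℕ) := by have := i.2; lia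
      simp [ρ, h]
    exact DFunLike.congr_fun this e
  rw [Ideal.span_le]
  rintro e ⟨j, hj, he⟩
  have h1 := Ideal.mem_map_of_mem ρ (key j)
  rw [← he, hρ, Ideal.map_span] at h1
  refine Ideal.span_mono ?_ h1
  rintro _ ⟨_, ⟨i, hi, rfl⟩, rfl⟩
  obtain ⟨e', he'⟩ := exists_incl_eq p f (hi.trans hj)
  rw [← he', hρ]
  exact ⟨i, hi.trans hj, he'⟩

/-- The `p`-adic completion of a ring. -/
abbrev PCompl (p : ℕ) (S : Type) [CommRing S] : Type :=
  AdicCompletion (Ideal.span {(p : S)}) S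

/-- The ideal `(f, δ f, …, δ^n f)` of the `p`-adic completion of `R[x, x', …, x^{(n)}]`. -/
def jetIdeal (p : ℕ) [Fact p.Prime] (f : (BaseRing p)[X]) (n : ℕ) :
    Ideal (PCompl p (JetPoly p n)) :=
  Ideal.span (algebraMap (JetPoly p n) (PCompl p (JetPoly p n)) '' jetEqs p f n)

theorem jetIdeal_le (p : ℕ) [Fact p.Prime] {f g : (BaseRing p)[X]} (hfg : f ∣ g) (n : ℕ) :
    jetIdeal p g n ≤ jetIdeal p f n := by
  have h := Ideal.map_mono (f := algebraMap (JetPoly p n) (PCompl p (JetPoly p n)))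
    (span_jetEqs_le p hfg n)
  rwa [Ideal.map_span, Ideal.map_span] at h

/-- The ring `𝒪^n(X)` of global functions on the `p`-jet space of order `n` of the scheme
`X = Spec R[x]/(f)`. -/
abbrev JetRing (p : ℕ) [Fact p.Prime] (f : (BaseRing p)[X]) (n : ℕ) : Type :=
  PCompl p (JetPoly p n) ⧸ jetIdeal p f n

/-- The homomorphism `R[x] → 𝒪^n(X)`. -/
def polyToJet (p : ℕ) [Fact p.Prime] (f : (BaseRing p)[X]) (n : ℕ) :
    (BaseRing p)[X] →ₐ[BaseRing p] JetRing p f n :=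
  Polynomial.aeval (Ideal.Quotient.mk (jetIdeal p f n)
    (algebraMap (JetPoly p n) (PCompl p (JetPoly p n)) (MvPolynomial.X 0)))

theorem polyToJet_eq (p : ℕ) [Fact p.Prime] (f : (BaseRing p)[X]) (n : ℕ) (g : (BaseRing p)[X]) :
    polyToJet p f n g = Ideal.Quotient.mk (jetIdeal p f n)
      (algebraMap (JetPoly p n) (PCompl p (JetPoly p n))
        (Polynomial.aeval (MvPolynomial.X 0) g)) := by
  have h : polyToJet p f n =
      ((Ideal.Quotient.mkₐ (BaseRing p) (jetIdeal p f n)).comp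
        (IsScalarTower.toAlgHom (BaseRing p) (JetPoly p n) (PCompl p (JetPoly p n)))).comp
        (Polynomial.aeval (MvPolynomial.X 0)) := by
    apply Polynomial.algHom_ext
    simp [polyToJet]
  rw [h]
  rfl

theorem polyToJet_self (p : ℕ) [Fact p.Prime] (f : (BaseRing p)[X]) (n : ℕ) :
    polyToJet p f n f = 0 := by
  rw [polyToJet_eq, Ideal.Quotient.eq_zero_iff_mem]
  refine Ideal.subset_span ⟨_, ⟨0, Nat.zero_le n, ?_⟩, rfl⟩
  rw [← Polynomial.aeval_algHom_apply]
  simp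

/-- The coordinate ring `𝒪(X) = R[x]/(f)` of `X`. -/
abbrev CoordRing (p : ℕ) [Fact p.Prime] (f : (BaseRing p)[X]) : Type :=
  (BaseRing p)[X] ⧸ Ideal.span {f}

/-- The homomorphism `𝒪(X) → 𝒪^n(X)`, `x ↦ x`, corresponding to the composition of the projection
from the `n`-th `p`-jet space to the `0`-th one, the `p`-adic completion of `X`, with the
canonical morphism from the latter to `X`. -/
def coordToJet (p : ℕ) [Fact p.Prime] (f : (BaseRing p)[X]) (n : ℕ) :
    CoordRing p f →ₐ[BaseRing p] JetRing p f n :=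
  Ideal.Quotient.liftₐ (Ideal.span {f}) (polyToJet p f n) (by
    intro a ha
    obtain ⟨b, rfl⟩ := Ideal.mem_span_singleton.1 ha
    rw [map_mul, polyToJet_self, zero_mul])

theorem coordToJet_mk (p : ℕ) [Fact p.Prime] (f : (BaseRing p)[X]) (n : ℕ) (g : (BaseRing p)[X]) :
    coordToJet p f n (Ideal.Quotient.mk (Ideal.span {f}) g) = polyToJet p f n g :=
  Ideal.Quotient.lift_mk _ _ _

/-- The equation `x^{p^ν} - 1` of `μ_{p^ν}`. -/
def muEq (p : ℕ) [Fact p.Prime] (ν : ℕ) : (BaseRing p)[X] :=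
  Polynomial.X ^ (p ^ ν) - 1

/-- The counit `𝒪(μ_{p^ν}) → R`, `x ↦ 1`, i.e. the unit section of `μ_{p^ν}`. -/
def muCounit (p : ℕ) [Fact p.Prime] (ν : ℕ) :
    CoordRing p (muEq p ν) →ₐ[BaseRing p] BaseRing p :=
  Ideal.Quotient.liftₐ (Ideal.span {muEq p ν}) (Polynomial.aeval 1) (by
    intro a ha
    obtain ⟨b, rfl⟩ := Ideal.mem_span_singleton.1 ha
    simp [muEq])

theorem muCounit_mk (p : ℕ) [Fact p.Prime] (ν : ℕ) (g : (BaseRing p)[X]) :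
    muCounit p ν (Ideal.Quotient.mk (Ideal.span {muEq p ν}) g) = Polynomial.aeval 1 g :=
  Ideal.Quotient.lift_mk _ _ _

/-- The ideal of `𝒪^n(μ_{p^ν})` that defines the preimage of the unit section. -/
def kernelIdeal (p : ℕ) [Fact p.Prime] (n ν : ℕ) : Ideal (JetRing p (muEq p ν) n) :=
  Ideal.map (coordToJet p (muEq p ν) n) (RingHom.ker (muCounit p ν))

/-- The ring `𝒪^n(μ_{p^ν})_1` of functions on the kernel of the projection from the `n`-th to the
`0`-th `p`-jet space of `μ_{p^ν}`, that is, on the preimage of the unit section. -/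
abbrev KernelRing (p : ℕ) [Fact p.Prime] (n ν : ℕ) : Type :=
  JetRing p (muEq p ν) n ⧸ kernelIdeal p n ν

theorem muEq_dvd (p : ℕ) [Fact p.Prime] {ν ν' : ℕ} (h : ν ≤ ν') : muEq p ν ∣ muEq p ν' := by
  obtain ⟨k, rfl⟩ := Nat.exists_eq_add_of_le h
  have := sub_dvd_pow_sub_pow ((Polynomial.X : (BaseRing p)[X]) ^ p ^ ν) 1 (p ^ k)
  rwa [one_pow, ← pow_mul, ← pow_add] at this

/-- The homomorphism `𝒪^n(μ_{p^ν'}) → 𝒪^n(μ_{p^ν})` induced by `μ_{p^ν} ⊆ μ_{p^ν'}`, `ν ≤ ν'`;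
it sends `x^{(i)}` to `x^{(i)}`. -/
def jetRes (p : ℕ) [Fact p.Prime] (n : ℕ) {ν ν' : ℕ} (h : ν ≤ ν') :
    JetRing p (muEq p ν') n →ₐ[BaseRing p] JetRing p (muEq p ν) n :=
  Ideal.Quotient.factorₐ (BaseRing p) (jetIdeal_le p (muEq_dvd p h) n)

theorem jetRes_mk (p : ℕ) [Fact p.Prime] (n : ℕ) {ν ν' : ℕ} (h : ν ≤ ν')
    (a : PCompl p (JetPoly p n)) :
    jetRes p n h (Ideal.Quotient.mk (jetIdeal p (muEq p ν') n) a)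
      = Ideal.Quotient.mk (jetIdeal p (muEq p ν) n) a :=
  Ideal.Quotient.factorₐ_apply_mk _ _ _

theorem kernelIdeal_le (p : ℕ) [Fact p.Prime] (n : ℕ) {ν ν' : ℕ} (h : ν ≤ ν') :
    kernelIdeal p n ν' ≤ Ideal.comap (jetRes p n h) (kernelIdeal p n ν) := by
  rw [kernelIdeal, Ideal.map_le_iff_le_comap]
  intro c hc
  obtain ⟨g, rfl⟩ := Ideal.Quotient.mk_surjective c
  rw [RingHom.mem_ker, muCounit_mk] at hc
  have h2 : Ideal.Quotient.mk (Ideal.span {muEq p ν}) g ∈ RingHom.ker (muCounit p ν) := by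
    rw [RingHom.mem_ker, muCounit_mk, hc]
  have h3 := Ideal.mem_map_of_mem (coordToJet p (muEq p ν) n) h2
  rw [coordToJet_mk, polyToJet_eq] at h3
  rw [Ideal.mem_comap, Ideal.mem_comap, coordToJet_mk, polyToJet_eq, jetRes_mk]
  exact h3

/-- The homomorphism `𝒪^n(μ_{p^ν'})_1 → 𝒪^n(μ_{p^ν})_1` induced by `μ_{p^ν} ⊆ μ_{p^ν'}`. -/
def kernelRes (p : ℕ) [Fact p.Prime] (n : ℕ) {ν ν' : ℕ} (h : ν ≤ ν') :
    KernelRing p n ν' →ₐ[BaseRing p] KernelRing p n ν :=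
  Ideal.quotientMapₐ (kernelIdeal p n ν) (jetRes p n h) (kernelIdeal_le p n h)

theorem kernelRes_mk (p : ℕ) [Fact p.Prime] (n : ℕ) {ν ν' : ℕ} (h : ν ≤ ν')
    (a : JetRing p (muEq p ν') n) :
    kernelRes p n h (Ideal.Quotient.mk (kernelIdeal p n ν') a)
      = Ideal.Quotient.mk (kernelIdeal p n ν) (jetRes p n h a) :=
  Ideal.quotient_map_mkₐ _ _ (kernelIdeal_le p n h)

/-- The inverse limit of the rings `𝒪^n(μ_{p^ν})_1`, `ν ≥ 1`. -/
def muLimit (p : ℕ) [Fact p.Prime] (n : ℕ) :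
    Subalgebra (BaseRing p) (∀ ν : ℕ+, KernelRing p n ν) where
  carrier := {a | ∀ (ν ν' : ℕ+) (h : (ν : ℕ) ≤ ν'), kernelRes p n h (a ν') = a ν}
  mul_mem' ha hb ν ν' h := by rw [Pi.mul_apply, map_mul, ha ν ν' h, hb ν ν' h, Pi.mul_apply]
  add_mem' ha hb ν ν' h := by rw [Pi.add_apply, map_add, ha ν ν' h, hb ν ν' h, Pi.add_apply]
  algebraMap_mem' r ν ν' h := by rw [Pi.algebraMap_apply, AlgHom.commutes, Pi.algebraMap_apply]

theorem map_span_p_pow_le (p : ℕ) {A S T : Type} [CommRing A] [CommRing S] [CommRing T]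
    [Algebra A S] [Algebra A T] (g : S →ₐ[A] T) (m : ℕ) :
    Ideal.span {(p : S)} ^ m ≤ Ideal.comap g (Ideal.span {(p : T)} ^ m) := by
  rw [← Ideal.map_le_iff_le_comap, Ideal.map_pow, Ideal.map_span, Set.image_singleton,
    map_natCast]

/-- The homomorphism `Ŝ → S/p^m S → T/p^m T` induced by `g : S → T`. -/
def complMapAux (p : ℕ) {A S T : Type} [CommRing A] [CommRing S] [CommRing T] [Algebra A S]
    [Algebra A T] (g : S →ₐ[A] T) (m : ℕ) : PCompl p S →ₐ[A] T ⧸ Ideal.span {(p : T)} ^ m :=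
  (Ideal.quotientMapₐ (Ideal.span {(p : T)} ^ m) g (map_span_p_pow_le p g m)).comp
    ((AdicCompletion.evalₐ (Ideal.span {(p : S)}) m).restrictScalars A)

theorem complMapAux_mk (p : ℕ) {A S T : Type} [CommRing A] [CommRing S] [CommRing T]
    [Algebra A S] [Algebra A T] (g : S →ₐ[A] T) (m : ℕ)
    (x : AdicCompletion.AdicCauchySequence (Ideal.span {(p : S)}) S) :
    complMapAux p g m (AdicCompletion.mk _ _ x) = Ideal.Quotient.mk _ (g (x.val m)) := by
  rw [complMapAux, AlgHom.comp_apply, AlgHom.restrictScalars_apply, AdicCompletion.evalₐ_mk,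
    Ideal.quotient_map_mkₐ, Ideal.Quotient.mkₐ_eq_mk]

theorem complMapAux_comp (p : ℕ) {A S T : Type} [CommRing A] [CommRing S] [CommRing T]
    [Algebra A S] [Algebra A T] (g : S →ₐ[A] T) {m k : ℕ} (hmk : m ≤ k) :
    (Ideal.Quotient.factorₐ A (Ideal.pow_le_pow_right hmk)).comp (complMapAux p g k)
      = complMapAux p g m := by
  ext x
  obtain ⟨x, rfl⟩ := AdicCompletion.mk_surjective _ _ x
  rw [AlgHom.comp_apply, complMapAux_mk, complMapAux_mk, Ideal.Quotient.factorₐ_apply_mk,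
    Ideal.Quotient.eq, ← map_sub]
  exact map_span_p_pow_le p g m
    (Ideal.Quotient.eq.1 (AdicCompletion.Ideal.mk_eq_mk _ hmk x))

/-- The homomorphism between `p`-adic completions induced by a homomorphism of `A`-algebras. -/
def complMap (p : ℕ) {A S T : Type} [CommRing A] [CommRing S] [CommRing T] [Algebra A S]
    [Algebra A T] (g : S →ₐ[A] T) : PCompl p S →ₐ[A] PCompl p T :=
  AdicCompletion.liftAlgHom (Ideal.span {(p : T)}) (complMapAux p g)
    (fun hmk => complMapAux_comp p g hmk)

theorem evalₐ_complMap (p : ℕ) {A S T : Type} [CommRing A] [CommRing S] [CommRing T]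
    [Algebra A S] [Algebra A T] (g : S →ₐ[A] T) (m : ℕ) (x : PCompl p S) :
    AdicCompletion.evalₐ (Ideal.span {(p : T)}) m (complMap p g x) = complMapAux p g m x :=
  AdicCompletion.evalₐ_liftAlgHom _ _ (fun hmk => complMapAux_comp p g hmk) _ _

theorem complMap_algebraMap (p : ℕ) {A S T : Type} [CommRing A] [CommRing S] [CommRing T]
    [Algebra A S] [Algebra A T] (g : S →ₐ[A] T) (s : S) :
    complMap p g (algebraMap S (PCompl p S) s) = algebraMap T (PCompl p T) (g s) := by
  refine AdicCompletion.ext_evalₐ fun m => ?_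
  rw [evalₐ_complMap, complMapAux, AlgHom.comp_apply, AlgHom.restrictScalars_apply,
    AlgHom.commutes, AlgHom.commutes]
  rfl

/-- The map `R[x', …, x^{(n)}]^ → 𝒪^n(μ_{p^ν})_1`, `x^{(i)} ↦ x^{(i)}`, induced by the inclusion
`R[x', …, x^{(n)}] ⊆ R[x, x', …, x^{(n)}]`. In the source `X i` stands for `x^{(i+1)}`. -/
def toKernelRing (p : ℕ) [Fact p.Prime] (n ν : ℕ) :
    PCompl p (MvPolynomial (Fin n) (BaseRing p)) →ₐ[BaseRing p] KernelRing p n ν :=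
  ((Ideal.Quotient.mkₐ (BaseRing p) (kernelIdeal p n ν)).comp
    (Ideal.Quotient.mkₐ (BaseRing p) (jetIdeal p (muEq p ν) n))).comp
    (complMap p (MvPolynomial.rename Fin.succ))

theorem toKernelRing_apply (p : ℕ) [Fact p.Prime] (n ν : ℕ)
    (a : PCompl p (MvPolynomial (Fin n) (BaseRing p))) :
    toKernelRing p n ν a = Ideal.Quotient.mk (kernelIdeal p n ν)
      (Ideal.Quotient.mk (jetIdeal p (muEq p ν) n) (complMap p (MvPolynomial.rename Fin.succ) a)) :=
  rfl

theorem kernelRes_toKernelRing (p : ℕ) [Fact p.Prime] (n : ℕ) {ν ν' : ℕ} (h : ν ≤ ν')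
    (a : PCompl p (MvPolynomial (Fin n) (BaseRing p))) :
    kernelRes p n h (toKernelRing p n ν' a) = toKernelRing p n ν a := by
  rw [toKernelRing_apply, toKernelRing_apply, kernelRes_mk, jetRes_mk]

/-- The canonical map from `R[x', …, x^{(n)}]^` to the inverse limit. -/
def toMuLimit (p : ℕ) [Fact p.Prime] (n : ℕ) :
    PCompl p (MvPolynomial (Fin n) (BaseRing p)) →ₐ[BaseRing p] muLimit p n :=
  (AlgHom.pi (fun ν : ℕ+ => toKernelRing p n ν)).codRestrict (muLimit p n)
    (fun a _ _ h => kernelRes_toKernelRing p n h a)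

end PJet

end

open scoped Polynomial

noncomputable section

namespace PJet

/-! ### Convergence in `p`-adic completions -/

section Completion

variable {p : ℕ} {S : Type} [CommRing S]

/-! Let `B = R[x', …, x^{(n)}]`, let `B^` be its `p`-adic completion and `𝔪 = (x', …, x^{(n)})` in
`B^`. Setting `x = 1` identifies `𝒪^n(μ_{p^ν})_1` with `B^/I_ν`, where `I_ν` is generated by the
values at `x = 1` of `δ^j(x^{p^ν} - 1)`, `j ≤ n` (`toKernelRing_surjective`, `ker_toKernelRing`).
The point is that the ideals `I_ν` are cofinal with the ideals `p^M 𝔪`. Injectivity then follows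
because `B^` is `p`-adically separated, and surjectivity because `B^` is `p`-adically complete and
`𝔪` is finitely generated (`PCompl.exists_lift`).

Cofinality is seen by trading `δ` for the ring homomorphism `φ`: modulo `δ^i h` with `i < j`,
`φ^j(h)` is `p^j δ^j(h)` (`phi_iterate_sub_mem`). At `x = 1` one has `φ^j(x) ≡ 1` mod `p`, so
`φ^j(x)^{p^ν} - 1` is highly divisible by `p` for large `ν`. Dividing by `p^j` shows the same for
the generators of `I_ν`, which moreover have no constant term (`exists_ker_le_pow_mul`). Conversely,
for odd `p`, `φ^j(x)^{p^ν} - 1` is `p^ν (φ^j(x) - 1)` times a unit, and `φ^j(x) - 1` is `p^j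
x^{(j)}` modulo the earlier variables. Hence `I_ν` contains a `p`-power multiple of each variable
(`exists_pow_mul_mem_ker`). -/

theorem mem_span_pow_smul_top_iff (m : ℕ) (x : PCompl p S) :
    x ∈ (Ideal.span {(p : S)} ^ m • ⊤ : Submodule S (PCompl p S)) ↔ (p : PCompl p S) ^ m ∣ x := by
  have h : ∀ y : PCompl p S, ((p : S) ^ m) • y = (p : PCompl p S) ^ m * y := by
    intro y
    rw [Algebra.smul_def, map_pow, map_natCast]
  rw [Ideal.span_singleton_pow, Submodule.ideal_span_singleton_smul,
    Submodule.mem_smul_pointwise_iff_exists]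
  constructor
  · rintro ⟨y, -, rfl⟩
    exact ⟨y, h y⟩
  · rintro ⟨y, rfl⟩
    exact ⟨y, trivial, h y⟩

theorem PCompl.isAdicComplete : IsAdicComplete (Ideal.span {(p : S)}) (PCompl p S) :=
  AdicCompletion.isAdicComplete (Submodule.fg_span_singleton _)

theorem PCompl.eq_zero_of_forall_pow_dvd {x : PCompl p S}
    (h : ∀ m : ℕ, (p : PCompl p S) ^ m ∣ x) : x = 0 := by
  have := PCompl.isAdicComplete (p := p) (S := S)
  refine IsHausdorff.haus (I := Ideal.span {(p : S)}) inferInstance x fun m => ?_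
  rw [SModEq.zero, mem_span_pow_smul_top_iff]
  exact h m

theorem PCompl.exists_series_sum (c : ℕ → PCompl p S) :
    ∃ s, ∀ m : ℕ, (p : PCompl p S) ^ m ∣ s - ∑ i ∈ Finset.range m, (p : PCompl p S) ^ i * c i := by
  have := PCompl.isAdicComplete (p := p) (S := S)
  obtain ⟨s, hs⟩ := IsPrecomplete.prec (I := Ideal.span {(p : S)}) (M := PCompl p S) inferInstance
    (f := fun m => ∑ i ∈ Finset.range m, (p : PCompl p S) ^ i * c i) (by
      intro m n hmn
      rw [SModEq.comm, SModEq.sub_mem, mem_span_pow_smul_top_iff,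
        ← Finset.sum_range_add_sum_Ico _ hmn, add_sub_cancel_left]
      refine Finset.dvd_sum fun i hi => Dvd.dvd.mul_right (pow_dvd_pow _ ?_) _
      exact (Finset.mem_Ico.1 hi).1)
  refine ⟨s, fun m => ?_⟩
  have h := (hs m).symm
  rwa [SModEq.sub_mem, mem_span_pow_smul_top_iff] at h

/-- The inverse is the geometric series in `-p a`. -/
theorem PCompl.isUnit_one_add (a : PCompl p S) : IsUnit (1 + p * a) := by
  obtain ⟨s, hs⟩ := PCompl.exists_series_sum (fun i => (-a) ^ i)
  refine .of_mul_eq_one s (sub_eq_zero.1 (PCompl.eq_zero_of_forall_pow_dvd fun m => ?_))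
  obtain ⟨r, hr⟩ := hs m
  have h1 := mul_neg_geom_sum (-(p * a)) m
  have h2 : ∑ i ∈ Finset.range m, (p : PCompl p S) ^ i * (-a) ^ i
      = ∑ i ∈ Finset.range m, (-(p * a)) ^ i := by
    refine Finset.sum_congr rfl fun i _ => ?_
    rw [← mul_pow, mul_neg]
  rw [h2] at hr
  have h3 : (-((p : PCompl p S) * a)) ^ m = p ^ m * (-a) ^ m := by rw [← mul_pow, mul_neg]
  rw [h3] at h1
  exact ⟨(1 + p * a) * r - (-a) ^ m, by linear_combination (1 + p * a) * hr + h1⟩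

/-- A sequence whose successive differences lie in `p^i 𝔪`, for a finitely generated ideal `𝔪`,
has a limit, to which it converges at the same speed. -/
theorem PCompl.exists_limit {ι : Type} [Fintype ι] (x : ι → PCompl p S) (b : ℕ → PCompl p S)
    (hb : ∀ i, ∃ y ∈ Ideal.span (Set.range x), b (i + 1) - b i = p ^ i * y) :
    ∃ s, ∀ m, ∃ y ∈ Ideal.span (Set.range x), s - b m = p ^ m * y := by
  have h : ∀ i, ∃ c : ι → PCompl p S, b (i + 1) - b i = p ^ i * ∑ j, c j * x j := by
    intro i
    obtain ⟨y, hy, hyi⟩ := hb i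
    obtain ⟨c, rfl⟩ := Ideal.mem_span_range_iff_exists_fun.1 hy
    exact ⟨c, hyi⟩
  choose c hc using h
  -- Summing the coefficient of each generator separately keeps the remainders in the ideal, without
  -- knowing that the ideal is closed.
  choose s hs using fun j => PCompl.exists_series_sum (fun i => c i j)
  choose r hr using hs
  have hbm : ∀ m, b m = b 0 + ∑ j, (∑ i ∈ Finset.range m, p ^ i * c i j) * x j := by
    intro m
    induction m with
    | zero => simp
    | succ m ih =>
      simp only [Finset.sum_range_succ, add_mul, Finset.sum_add_distrib, mul_assoc]
      rw [← Finset.mul_sum, ← hc, ← add_assoc, ← ih]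
      ring
  refine ⟨b 0 + ∑ j, s j * x j, fun m => ⟨∑ j, r j m * x j, ?_, ?_⟩⟩
  · exact Ideal.mem_span_range_iff_exists_fun.2 ⟨_, rfl⟩
  · rw [hbm m, add_sub_add_left_eq_sub, ← Finset.sum_sub_distrib, Finset.mul_sum]
    refine Finset.sum_congr rfl fun j _ => ?_
    rw [← sub_mul, hr, mul_assoc]

/-- Let `I` be a decreasing sequence of ideals of a `p`-adically complete ring which is cofinal with
the sequence `p^i 𝔪` for a finitely generated ideal `𝔪`. Then compatible systems of classes modulo
the ideals `I ν` lift. -/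
theorem PCompl.exists_lift {ι : Type} [Fintype ι] (x : ι → PCompl p S)
    (I : ℕ+ → Ideal (PCompl p S))
    (hI : ∀ ν, ∃ N : ℕ, ∀ y ∈ Ideal.span (Set.range x), p ^ N * y ∈ I ν)
    (hI' : ∀ M : ℕ, ∃ K : ℕ+, ∀ k ≥ K, ∀ z ∈ I k, ∃ y ∈ Ideal.span (Set.range x), z = p ^ M * y)
    (a : ℕ+ → PCompl p S) (ha : ∀ ν k : ℕ+, ν ≤ k → a k - a ν ∈ I ν) :
    ∃ b, ∀ ν, b - a ν ∈ I ν := by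
  choose K hK using hI'
  obtain ⟨k, hk1, hkK⟩ : ∃ k : ℕ → ℕ+, (∀ m, k m < k (m + 1)) ∧ ∀ m, K m ≤ k m := by
    -- A strictly increasing sequence dominating `K`; along it the differences of `a` lie in `p^m
    -- 𝔪`.
    refine ⟨fun m => Nat.rec (K 0) (fun i r => max r (K (i + 1)) + 1) m, fun m =>
      (le_max_left _ _).trans_lt (PNat.lt_add_right _ _), ?_⟩
    rintro (_ | m)
    · exact le_rfl
    · exact (le_max_right _ _).trans (PNat.lt_add_right _ _).le
  have hkν : ∀ m : ℕ, m < PNat.val (k m) := by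
    intro m
    induction m with
    | zero => exact (k 0).pos
    | succ m ih =>
      have h : PNat.val (k m) < PNat.val (k (m + 1)) := hk1 m
      lia
  obtain ⟨b, hb⟩ := PCompl.exists_limit x (fun m => a (k m)) (fun i =>
    hK i (k i) (hkK i) _ (ha _ _ (hk1 i).le))
  refine ⟨b, fun ν => ?_⟩
  obtain ⟨N, hN⟩ := hI ν
  -- Index at least `N` puts the remainder in `I ν`; index at least `ν` makes `k` exceed `ν`, so
  -- that compatibility applies.
  obtain ⟨y, hy, hby⟩ := hb (max N ν)
  have h1 : b - a (k (max N ν)) ∈ I ν := by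
    rw [hby, ← Nat.sub_add_cancel (le_max_left N ν), pow_add, mul_assoc]
    exact Ideal.mul_mem_left _ _ (hN y hy)
  have h2 : ν ≤ k (max N ν) := ((le_max_right N (ν : ℕ)).trans_lt (hkν _)).le
  simpa using add_mem h1 (ha _ _ h2)

end Completion

/-! ### Powers of elements congruent to 1 modulo `p` -/

section Powers

variable {p : ℕ} {B : Type} [CommRing B]

/-- Each `p`-th power multiplies `p t'` by the geometric sum of `1 + p t'`, which is `p` modulo
`p^2` when `p` is odd. For `p = 2` the extra factor in `(1 + 2t)^2 - 1 = 4t(1 + t)` need not be `1`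
modulo `2`. -/
theorem one_add_pow_prime_pow (hp : Odd p) (t : B) (ν : ℕ) :
    ∃ w, (1 + p * t) ^ p ^ ν - 1 = p ^ ν * (p * t) * (1 + p * w) := by
  induction ν with
  | zero => exact ⟨0, by simp⟩
  | succ ν ih =>
    obtain ⟨w, hw⟩ := ih
    set t' : B := p ^ ν * t * (1 + p * w) with ht'
    have h1 : (1 + p * t) ^ p ^ ν = 1 + p * t' := by linear_combination hw
    obtain ⟨v, hv⟩ := odd_sq_dvd_geom_sum₂_sub (a := (1 : B)) (b := t') hp
    have h2 := (Commute.all (1 + (p : B) * t') 1).geom_sum₂_mul p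
    refine ⟨w + v + p * w * v, ?_⟩
    rw [pow_succ p ν, pow_mul, h1]
    rw [one_pow] at hv h2
    linear_combination -h2 + (p * t') * hv + (p + p ^ 2 * v) * p * ht'

end Powers

/-! ### The jet equations on the unit section -/

section Equations

variable (p : ℕ) [Fact p.Prime]

theorem phi_X (i : ℕ) : phi p (MvPolynomial.X i)
    = MvPolynomial.X i ^ p + (p : DeltaPoly p) * MvPolynomial.X (i + 1) := by
  simp [phi]

/-- Up to a combination of `h, δ h, …, δ^{j-1} h`, the iterate `φ^j(h)` is `p^j δ^j h`. -/
theorem phi_iterate_sub_mem (h : DeltaPoly p) (j : ℕ) :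
    (phi p)^[j] h - (p : DeltaPoly p) ^ j * (delta p)^[j] h
      ∈ Ideal.span {g | ∃ i < j, g = (delta p)^[i] h} := by
  induction j with
  | zero => simp
  | succ j ih =>
    have hphi : ∀ i, phi p ((delta p)^[i] h)
        = ((delta p)^[i] h) ^ p + p * (delta p)^[i + 1] h := by
      intro i
      rw [Function.iterate_succ_apply', p_mul_delta]
      ring
    have hmem : ∀ i < j + 1, (delta p)^[i] h
        ∈ Ideal.span {g | ∃ i < j + 1, g = (delta p)^[i] h} :=
      fun i hi => Ideal.subset_span ⟨i, hi, rfl⟩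
    have hle : Ideal.span {g | ∃ i < j, g = (delta p)^[i] h}
        ≤ Ideal.comap (phi p) (Ideal.span {g | ∃ i < j + 1, g = (delta p)^[i] h}) := by
      rw [Ideal.span_le]
      rintro _ ⟨i, hi, rfl⟩
      rw [SetLike.mem_coe, Ideal.mem_comap, hphi]
      refine add_mem (Ideal.pow_mem_of_mem _ (hmem i (by lia)) _
        (Fact.out : p.Prime).pos) (Ideal.mul_mem_left _ _ (hmem (i + 1) (by lia)))
    have h1 := hle ih
    rw [Ideal.mem_comap, map_sub, map_mul, map_pow, map_natCast, hphi,
      ← Function.iterate_succ_apply' (phi p)] at h1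
    -- Applying `φ` to `p^j δ^j h` gives `p^{j+1} δ^{j+1} h` and this error term, which the enlarged
    -- ideal absorbs.
    have h2 : (p : DeltaPoly p) ^ j * ((delta p)^[j] h) ^ p
        ∈ Ideal.span {g | ∃ i < j + 1, g = (delta p)^[i] h} :=
      Ideal.mul_mem_left _ _ (Ideal.pow_mem_of_mem _ (hmem j (by lia)) _
        (Fact.out : p.Prime).pos)
    convert add_mem h1 h2 using 1
    ring

theorem delta_iterate_X (i : ℕ) : (delta p)^[i] (MvPolynomial.X 1) = MvPolynomial.X (i + 1) := by
  induction i with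
  | zero => rfl
  | succ i ih => rw [Function.iterate_succ_apply', ih, delta_X]

theorem natCast_pow_mul_cancel {σ : Type} {j : ℕ} {x y : MvPolynomial σ (BaseRing p)}
    (h : (p : MvPolynomial σ (BaseRing p)) ^ j * x = (p : MvPolynomial σ (BaseRing p)) ^ j * y) :
    x = y := by
  refine mul_left_cancel₀ (pow_ne_zero _ ?_) h
  rw [← map_natCast (MvPolynomial.C : BaseRing p →+* _), ← map_zero MvPolynomial.C]
  exact fun h => p_ne_zero_base p (MvPolynomial.C_injective _ _ h)

/-- Restriction to the unit section: `x ↦ 1`, `x^{(i)} ↦ x^{(i)}` for `1 ≤ i ≤ n` and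
`x^{(i)} ↦ 0` for `i > n`. -/
def evalOne (n : ℕ) : DeltaPoly p →ₐ[BaseRing p] MvPolynomial (Fin n) (BaseRing p) :=
  MvPolynomial.aeval fun i =>
    Nat.casesOn i 1 (fun i => if h : i < n then MvPolynomial.X ⟨i, h⟩ else 0)

variable {n : ℕ}

@[simp] theorem evalOne_X_zero : evalOne p n (MvPolynomial.X 0) = 1 := by
  simp [evalOne]

@[simp] theorem evalOne_X_succ (i : Fin n) :
    evalOne p n (MvPolynomial.X ((i : ℕ) + 1)) = MvPolynomial.X i := by
  simp [evalOne]

/-- Evaluation at the point `(1, 0, 0, …)` commutes with Frobenius lifts, because `φ(x) = x^p + p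
x'` takes the value `1` there and each `φ(x^{(i)})`, `i ≥ 1`, the value `0`. -/
theorem constantCoeff_evalOne_phi (f : DeltaPoly p) :
    MvPolynomial.constantCoeff (evalOne p n (phi p f))
      = WittVector.frobenius (MvPolynomial.constantCoeff (evalOne p n f)) := by
  have hX : ∀ i, MvPolynomial.constantCoeff (evalOne p n (MvPolynomial.X (i + 1))) = 0 := by
    intro i
    by_cases h : i < n <;> simp [evalOne, h]
  have h : (MvPolynomial.constantCoeff.comp (evalOne p n).toRingHom).comp (phi p)
      = (WittVector.frobenius).comp
        (MvPolynomial.constantCoeff.comp (evalOne p n).toRingHom) := by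
    apply MvPolynomial.ringHom_ext
    · intro r
      simp [phi, evalOne]
    · rintro (_ | i)
      · simp [phi_X, hX]
      · simp [phi_X, hX, (Fact.out : p.Prime).ne_zero]
  exact DFunLike.congr_fun h f

theorem constantCoeff_evalOne_delta {f : DeltaPoly p}
    (hf : MvPolynomial.constantCoeff (evalOne p n f) = 0) :
    MvPolynomial.constantCoeff (evalOne p n (delta p f)) = 0 := by
  have h := congrArg (fun g => MvPolynomial.constantCoeff (evalOne p n g)) (p_mul_delta p f)
  simp only [map_mul, map_sub, map_pow, map_natCast, constantCoeff_evalOne_phi, hf, map_zero] at h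
  rw [zero_pow (Fact.out : p.Prime).ne_zero, sub_zero] at h
  exact (mul_eq_zero.1 h).resolve_left (p_ne_zero_base p)

theorem mem_span_X_iff (f : MvPolynomial (Fin n) (BaseRing p)) :
    f ∈ Ideal.span (Set.range MvPolynomial.X) ↔ MvPolynomial.constantCoeff f = 0 := by
  have h : f - MvPolynomial.C (MvPolynomial.constantCoeff f)
      ∈ Ideal.span (Set.range (MvPolynomial.X (R := BaseRing p) (σ := Fin n))) := by
    induction f using MvPolynomial.induction_on with
    | C a => simp
    | add f g hf hg =>
      rw [map_add, map_add, add_sub_add_comm]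
      exact add_mem hf hg
    | mul_X f i hf =>
      rw [map_mul, MvPolynomial.constantCoeff_X, mul_zero, map_zero, sub_zero]
      exact Ideal.mul_mem_left _ _ (Ideal.subset_span ⟨i, rfl⟩)
  refine ⟨fun hf => ?_, fun hf => by simpa [hf] using h⟩
  have hle : Ideal.span (Set.range (MvPolynomial.X (R := BaseRing p) (σ := Fin n)))
      ≤ RingHom.ker MvPolynomial.constantCoeff := by
    rw [Ideal.span_le]
    rintro _ ⟨i, rfl⟩
    simp
  exact hle hf

/-- The equation `δ^j(x^{p^ν} - 1)` of the jet space of `μ_{p^ν}`, restricted to the unit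
section. -/
def kernelEq (n ν j : ℕ) : MvPolynomial (Fin n) (BaseRing p) :=
  evalOne p n ((delta p)^[j] (MvPolynomial.X 0 ^ p ^ ν - 1))

/-- The point `(1, 0, 0, …)` satisfies all jet equations. This is what yields `p^M 𝔪`, rather than
only `(p^M)`, in `exists_ker_le_pow_mul`. -/
theorem constantCoeff_kernelEq (ν j : ℕ) :
    MvPolynomial.constantCoeff (kernelEq p n ν j) = 0 := by
  induction j with
  | zero => simp [kernelEq]
  | succ j ih =>
    rw [kernelEq, Function.iterate_succ_apply']
    exact constantCoeff_evalOne_delta p ih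

/-- The restriction of `φ^j(x)` to the unit section. -/
def phiEq (n j : ℕ) : MvPolynomial (Fin n) (BaseRing p) :=
  evalOne p n ((phi p)^[j] (MvPolynomial.X 0))

theorem phiEq_succ (j : ℕ) : phiEq p n (j + 1)
    = phiEq p n j ^ p + p * evalOne p n ((phi p)^[j] (MvPolynomial.X 1)) := by
  rw [phiEq, phiEq, Function.iterate_succ_apply, phi_X, iterate_map_add, iterate_map_mul,
    iterate_map_pow, map_add, map_mul, map_pow,
    Function.iterate_fixed (map_natCast (phi p) p), map_natCast, zero_add]

theorem dvd_phiEq_sub_one (j : ℕ) :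
    (p : MvPolynomial (Fin n) (BaseRing p)) ∣ phiEq p n j - 1 := by
  induction j with
  | zero => simp [phiEq]
  | succ j ih =>
    rw [phiEq_succ, add_sub_right_comm]
    exact dvd_add (ih.trans (sub_one_dvd_pow_sub_one _ p)) (dvd_mul_right _ _)

/-- `φ^j(x^{p^ν} - 1)` is a combination of `δ^i(x^{p^ν} - 1)`, `i ≤ j`. -/
theorem phiEq_pow_sub_mem (ν j : ℕ) :
    phiEq p n j ^ p ^ ν - 1 - p ^ j * kernelEq p n ν j
      ∈ Ideal.span {g | ∃ i < j, g = kernelEq p n ν i} := by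
  have h := Ideal.mem_map_of_mem (evalOne p n)
    (phi_iterate_sub_mem p (MvPolynomial.X 0 ^ p ^ ν - 1) j)
  rw [Ideal.map_span, iterate_map_sub, iterate_map_pow, iterate_map_one, map_sub, map_sub, map_mul,
    map_pow, map_pow, map_natCast, map_one] at h
  refine Ideal.span_mono ?_ h
  rintro _ ⟨_, ⟨i, hi, rfl⟩, rfl⟩
  exact ⟨i, hi, rfl⟩

/-- Triangularity of the `φ^j(x) - 1` in the variables. The comparison of `φ^j` with `p^j δ^j` is
applied to `x'` and not to `x`, since for `x` the error ideal would contain `x = 1`. -/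
theorem phiEq_succ_sub_mem (j : ℕ) :
    phiEq p n (j + 1) - 1 - p ^ (j + 1) * evalOne p n (MvPolynomial.X (j + 1))
      ∈ Ideal.span {g | ∃ i < j, g = evalOne p n (MvPolynomial.X (i + 1))} := by
  have h : ∀ j, evalOne p n ((phi p)^[j] (MvPolynomial.X 1))
      - p ^ j * evalOne p n (MvPolynomial.X (j + 1))
      ∈ Ideal.span {g | ∃ i < j, g = evalOne p n (MvPolynomial.X (i + 1))} := by
    intro j
    have h := Ideal.mem_map_of_mem (evalOne p n) (phi_iterate_sub_mem p (MvPolynomial.X 1) j)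
    rw [Ideal.map_span, map_sub, map_mul, map_pow, map_natCast, delta_iterate_X] at h
    refine Ideal.span_mono ?_ h
    rintro _ ⟨_, ⟨i, hi, rfl⟩, rfl⟩
    exact ⟨i, hi, by rw [delta_iterate_X]⟩
  have h0 : phiEq p n j - 1
      ∈ Ideal.span {g | ∃ i < j, g = evalOne p n (MvPolynomial.X (i + 1))} := by
    induction j with
    | zero => simp [phiEq]
    | succ j ih =>
      have hle : Ideal.span {g | ∃ i < j, g = evalOne p n (MvPolynomial.X (i + 1))}
          ≤ Ideal.span {g | ∃ i < j + 1, g = evalOne p n (MvPolynomial.X (i + 1))} := by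
        refine Ideal.span_mono ?_
        rintro _ ⟨i, hi, rfl⟩
        exact ⟨i, by lia, rfl⟩
      have h1 := Ideal.mem_of_dvd _ (sub_one_dvd_pow_sub_one (phiEq p n j) p) (hle ih)
      have h2 : evalOne p n (MvPolynomial.X (j + 1))
          ∈ Ideal.span {g | ∃ i < j + 1, g = evalOne p n (MvPolynomial.X (i + 1))} :=
        Ideal.subset_span ⟨j, by lia, rfl⟩
      rw [phiEq_succ]
      convert add_mem (add_mem h1
          (Ideal.mul_mem_left _ (p : MvPolynomial (Fin n) (BaseRing p)) (hle (h j))))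
        (Ideal.mul_mem_left _ ((p : MvPolynomial (Fin n) (BaseRing p)) ^ (j + 1)) h2) using 1
      ring
  have h1 := Ideal.mem_of_dvd _ (sub_one_dvd_pow_sub_one (phiEq p n j) p) h0
  rw [phiEq_succ]
  convert add_mem h1 (Ideal.mul_mem_left _ (p : MvPolynomial (Fin n) (BaseRing p)) (h j)) using 1
  ring

/-- Modulo the equations of lower order, `p^j` times this one is `φ^j(x)^{p^k} - 1`, a `p^k`-th
power of something congruent to `1` mod `p`, minus `1`. Asking for divisibility by `p^{M+j}` of
everything else leaves `p^M` after cancelling `p^j`. -/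
theorem exists_pow_dvd_kernelEq (j M : ℕ) :
    ∃ K : ℕ, ∀ k ≥ K, (p : MvPolynomial (Fin n) (BaseRing p)) ^ M ∣ kernelEq p n k j := by
  induction j using Nat.strong_induction_on generalizing M with
  | _ j ih =>
    choose! K hK using fun i (hi : i < j) => ih i hi (M + j)
    refine ⟨(Finset.range j).sup K + (M + j), fun k hk => ?_⟩
    have h1 : (p : MvPolynomial (Fin n) (BaseRing p)) ^ (M + j) ∣ phiEq p n j ^ p ^ k - 1 := by
      have h := dvd_sub_pow_of_dvd_sub (dvd_phiEq_sub_one p (n := n) j) k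
      rw [one_pow] at h
      exact (pow_dvd_pow _ (by lia)).trans h
    have h2 : Ideal.span {g | ∃ i < j, g = kernelEq p n k i}
        ≤ Ideal.span {(p : MvPolynomial (Fin n) (BaseRing p)) ^ (M + j)} := by
      rw [Ideal.span_le]
      rintro _ ⟨i, hi, rfl⟩
      refine Ideal.mem_span_singleton.2 (hK i hi k ?_)
      have := Finset.le_sup (f := K) (Finset.mem_range.2 hi)
      lia
    have h3 := (dvd_sub_right h1).1 (Ideal.mem_span_singleton.1 (h2 (phiEq_pow_sub_mem p k j)))
    obtain ⟨r, hr⟩ := h3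
    refine ⟨r, natCast_pow_mul_cancel p (j := j) ?_⟩
    rw [hr]
    ring

end Equations

/-! ### Functoriality of completion -/

section ComplMap

variable {p : ℕ} {A S T : Type} [CommRing A] [CommRing S] [CommRing T] [Algebra A S] [Algebra A T]

theorem evalₐ_complMap_of_eq_mk (g : S →ₐ[A] T) {m : ℕ} {x : PCompl p S} {b : S}
    (hb : AdicCompletion.evalₐ (Ideal.span {(p : S)}) m x = Ideal.Quotient.mk _ b) :
    AdicCompletion.evalₐ (Ideal.span {(p : T)}) m (complMap p g x) = Ideal.Quotient.mk _ (g b) := by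
  rw [evalₐ_complMap, complMapAux, AlgHom.comp_apply, AlgHom.restrictScalars_apply, hb,
    Ideal.quotient_map_mkₐ, Ideal.Quotient.mkₐ_eq_mk]

theorem complMap_comp_apply {U : Type} [CommRing U] [Algebra A U] (g : S →ₐ[A] T) (h : T →ₐ[A] U)
    (x : PCompl p S) : complMap p (h.comp g) x = complMap p h (complMap p g x) := by
  refine AdicCompletion.ext_evalₐ fun m => ?_
  obtain ⟨b, hb⟩ := Ideal.Quotient.mk_surjective
    (AdicCompletion.evalₐ (Ideal.span {(p : S)}) m x)
  rw [evalₐ_complMap_of_eq_mk h (evalₐ_complMap_of_eq_mk g hb.symm),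
    evalₐ_complMap_of_eq_mk _ hb.symm, AlgHom.comp_apply]

theorem complMap_complMap_of_leftInverse {g : S →ₐ[A] T} {h : T →ₐ[A] S}
    (hgh : ∀ x, h (g x) = x) (x : PCompl p S) : complMap p h (complMap p g x) = x := by
  refine AdicCompletion.ext_evalₐ fun m => ?_
  obtain ⟨b, hb⟩ := Ideal.Quotient.mk_surjective
    (AdicCompletion.evalₐ (Ideal.span {(p : S)}) m x)
  rw [evalₐ_complMap_of_eq_mk h (evalₐ_complMap_of_eq_mk g hb.symm), hgh, hb]

/-- If `S` is a domain and `g : S → S` is congruent to the identity modulo `u ≠ 0`, then so is the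
completion of `g`. -/
theorem dvd_complMap_sub [IsDomain S] {u : S} (hu : u ≠ 0) {g : S →ₐ[A] S}
    (hg : ∀ x, u ∣ g x - x) (x : PCompl p S) :
    algebraMap S (PCompl p S) u ∣ complMap p g x - x := by
  choose d hd using hg
  obtain ⟨x, rfl⟩ := AdicCompletion.mk_surjective _ _ x
  have hcauchy : ∀ m, d (x m) ≡ d (x (m + 1))
      [SMOD (Ideal.span {(p : S)} ^ m • ⊤ : Submodule S S)] := by
    intro m
    have h := x.2 (Nat.le_succ m)
    rw [SModEq.sub_mem, smul_eq_mul, Ideal.mul_top, Ideal.span_singleton_pow,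
      Ideal.mem_span_singleton] at h ⊢
    obtain ⟨c, hc⟩ := h
    refine ⟨d c, mul_left_cancel₀ hu ?_⟩
    -- From `x_m - x_{m+1} = p^m c`, applying `g` and subtracting gives `u` times the wanted
    -- relation between the quotients `d`; then `u` cancels in the domain `S`.
    have hc' := congrArg g hc
    rw [map_sub, map_mul, map_pow, map_natCast] at hc'
    linear_combination hc' - hc - hd (x.val m) + hd (x.val (m + 1)) + (p : S) ^ m * hd c
  refine ⟨AdicCompletion.mk _ _
      (AdicCompletion.AdicCauchySequence.mk _ _ (fun m => d (x m)) hcauchy),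
    AdicCompletion.ext_evalₐ fun m => ?_⟩
  rw [map_sub, map_mul, evalₐ_complMap_of_eq_mk g (AdicCompletion.evalₐ_mk _ _ _),
    AdicCompletion.evalₐ_mk, AdicCompletion.evalₐ_mk, AlgHom.commutes, ← map_sub]
  change _ = Ideal.Quotient.mk _ u * Ideal.Quotient.mk _ (d (x m))
  rw [← map_mul, ← hd]

end ComplMap

/-! ### Presentation of the kernel rings and cofinality of the ideals -/

section KernelRing

variable (p : ℕ) [Fact p.Prime] {n : ℕ}

/-- The homomorphism `R[x, x', …, x^{(n)}] → R[x', …, x^{(n)}]`, `x ↦ 1`. -/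
def jetEvalOne (n : ℕ) : JetPoly p n →ₐ[BaseRing p] MvPolynomial (Fin n) (BaseRing p) :=
  (evalOne p n).comp (incl p n)

theorem jetEvalOne_X_zero : jetEvalOne p n (MvPolynomial.X 0) = 1 := by
  simp [jetEvalOne]

theorem jetEvalOne_rename (f : MvPolynomial (Fin n) (BaseRing p)) :
    jetEvalOne p n (MvPolynomial.rename Fin.succ f) = f := by
  have h : (jetEvalOne p n).comp (MvPolynomial.rename Fin.succ) = AlgHom.id _ _ := by
    apply MvPolynomial.algHom_ext
    intro i
    simp [jetEvalOne]
  exact DFunLike.congr_fun h f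

/-- Substituting `x = 1` changes nothing modulo `x - 1`; it suffices to check this on the variables.
-/
theorem X_zero_sub_one_dvd (f : JetPoly p n) :
    MvPolynomial.X 0 - 1 ∣ ((MvPolynomial.rename Fin.succ).comp (jetEvalOne p n)) f - f := by
  induction f using MvPolynomial.induction_on with
  | C a => simp [← MvPolynomial.algebraMap_eq]
  | add f g hf hg =>
    rw [map_add, add_sub_add_comm]
    exact dvd_add hf hg
  | mul_X f i hf =>
    have hi : MvPolynomial.X 0 - 1 ∣ ((MvPolynomial.rename Fin.succ).comp (jetEvalOne p n))
        (MvPolynomial.X i) - MvPolynomial.X i := by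
      refine Fin.cases ?_ (fun i => ?_) i
      · rw [AlgHom.comp_apply, jetEvalOne_X_zero, map_one, ← neg_sub, neg_dvd]
      · simp [jetEvalOne]
    rw [map_mul]
    obtain ⟨a, ha⟩ := hf
    obtain ⟨b, hb⟩ := hi
    exact ⟨((MvPolynomial.rename Fin.succ).comp (jetEvalOne p n)) f * b + a * MvPolynomial.X i,
      by linear_combination ((MvPolynomial.rename Fin.succ).comp (jetEvalOne p n)) f * hb
        + MvPolynomial.X i * ha⟩

theorem X_zero_sub_one_dvd_complMap_sub (a : PCompl p (JetPoly p n)) :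
    algebraMap (JetPoly p n) (PCompl p (JetPoly p n)) (MvPolynomial.X 0 - 1)
      ∣ complMap p (MvPolynomial.rename Fin.succ) (complMap p (jetEvalOne p n) a) - a := by
  rw [← complMap_comp_apply]
  refine dvd_complMap_sub ?_ (X_zero_sub_one_dvd p) a
  intro h
  have h0 := congrArg (MvPolynomial.aeval (fun _ => (0 : BaseRing p))) h
  simp at h0

/-- The homomorphism from the completion of `R[x, x', …, x^{(n)}]` onto `𝒪^n(μ_{p^ν})_1`. -/
def toKernel (n ν : ℕ) : PCompl p (JetPoly p n) →+* KernelRing p n ν :=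
  (Ideal.Quotient.mk (kernelIdeal p n ν)).comp (Ideal.Quotient.mk (jetIdeal p (muEq p ν) n))

theorem toKernel_surjective (ν : ℕ) : Function.Surjective (toKernel p n ν) :=
  Ideal.Quotient.mk_surjective.comp Ideal.Quotient.mk_surjective

theorem toKernel_X_zero_sub_one (ν : ℕ) :
    toKernel p n ν (algebraMap (JetPoly p n) (PCompl p (JetPoly p n)) (MvPolynomial.X 0 - 1)) = 0 := by
  have h : Ideal.Quotient.mk (Ideal.span {muEq p ν}) (Polynomial.X - 1)
      ∈ RingHom.ker (muCounit p ν) := by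
    rw [RingHom.mem_ker, muCounit_mk]
    simp
  have h1 := Ideal.mem_map_of_mem (coordToJet p (muEq p ν) n) h
  rw [coordToJet_mk, polyToJet_eq, map_sub, Polynomial.aeval_X, map_one] at h1
  exact Ideal.Quotient.eq_zero_iff_mem.2 h1

/-- Substituting `x = 1` changes `a` by a multiple of `x - 1` even in the completion, and `x - 1`
dies on the unit section. -/
theorem toKernelRing_complMap_jetEvalOne (ν : ℕ) (a : PCompl p (JetPoly p n)) :
    toKernelRing p n ν (complMap p (jetEvalOne p n) a) = toKernel p n ν a := by
  obtain ⟨b, hb⟩ := X_zero_sub_one_dvd_complMap_sub p a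
  change toKernel p n ν (complMap p (MvPolynomial.rename Fin.succ) _) = _
  rw [← sub_eq_zero, ← map_sub, hb, map_mul, toKernel_X_zero_sub_one, zero_mul]

theorem toKernelRing_surjective (ν : ℕ) : Function.Surjective (toKernelRing p n ν) := by
  intro y
  obtain ⟨a, rfl⟩ := toKernel_surjective p ν y
  exact ⟨_, toKernelRing_complMap_jetEvalOne p ν a⟩

/-- The ideal of `R[x', …, x^{(n)}]` generated by the equations of the jet space of `μ_{p^ν}`,
restricted to the unit section. -/
def kernelEqIdeal (n ν : ℕ) : Ideal (MvPolynomial (Fin n) (BaseRing p)) :=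
  Ideal.span {g | ∃ j ≤ n, g = kernelEq p n ν j}

theorem polyIncl_muEq (ν : ℕ) : polyIncl p (muEq p ν) = MvPolynomial.X 0 ^ p ^ ν - 1 := by
  simp [muEq]

/-- For `≤`, evaluation at `x = 1` modulo the right-hand ideal kills the jet equations and every
`g(x)` with `g(1) = 0`, so it factors through the kernel ring; it is also a left inverse of the
inclusion of variables. For `≥`, each generator is the value at `x = 1` of a jet equation. -/
theorem ker_toKernelRing (ν : ℕ) : RingHom.ker (toKernelRing p n ν)
    = (kernelEqIdeal p n ν).map (algebraMap _ (PCompl p (MvPolynomial (Fin n) (BaseRing p)))) := by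
  apply le_antisymm
  · set I := (kernelEqIdeal p n ν).map
      (algebraMap _ (PCompl p (MvPolynomial (Fin n) (BaseRing p)))) with hI
    let r : PCompl p (JetPoly p n) →+* PCompl p (MvPolynomial (Fin n) (BaseRing p)) ⧸ I :=
      (Ideal.Quotient.mk I).comp (complMap p (jetEvalOne p n)).toRingHom
    have hr : ∀ x ∈ jetIdeal p (muEq p ν) n, r x = 0 := by
      have hle : jetIdeal p (muEq p ν) n ≤ RingHom.ker r := by
        rw [jetIdeal, Ideal.span_le]
        rintro _ ⟨g, ⟨j, hj, hg⟩, rfl⟩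
        refine Ideal.Quotient.eq_zero_iff_mem.2 ?_
        change complMap p (jetEvalOne p n) _ ∈ I
        rw [complMap_algebraMap]
        refine Ideal.mem_map_of_mem _ (Ideal.subset_span ⟨j, hj, ?_⟩)
        rw [jetEvalOne, AlgHom.comp_apply, hg, polyIncl_muEq, kernelEq]
      exact hle
    have hk : kernelIdeal p n ν ≤ RingHom.ker (Ideal.Quotient.lift _ r hr) := by
      rw [kernelIdeal, Ideal.map_le_iff_le_comap]
      intro c hc
      obtain ⟨g, rfl⟩ := Ideal.Quotient.mk_surjective c
      rw [RingHom.mem_ker, muCounit_mk] at hc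
      rw [Ideal.mem_comap, coordToJet_mk, polyToJet_eq, RingHom.mem_ker, Ideal.Quotient.lift_mk]
      change Ideal.Quotient.mk I (complMap p (jetEvalOne p n) _) = 0
      rw [complMap_algebraMap, ← Polynomial.aeval_algHom_apply, jetEvalOne_X_zero,
        ← map_one (algebraMap (BaseRing p) (MvPolynomial (Fin n) (BaseRing p))),
        Polynomial.aeval_algebraMap_apply, hc]
      simp
    intro a ha
    have h1 := hk (Ideal.Quotient.eq_zero_iff_mem.1 ((toKernelRing_apply p n ν a).symm.trans ha))
    rw [RingHom.mem_ker, Ideal.Quotient.lift_mk] at h1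
    have h2 := Ideal.Quotient.eq_zero_iff_mem.1 h1
    change complMap p (jetEvalOne p n) _ ∈ I at h2
    rwa [complMap_complMap_of_leftInverse (jetEvalOne_rename p)] at h2
  · rw [Ideal.map_le_iff_le_comap, kernelEqIdeal, Ideal.span_le]
    rintro _ ⟨j, hj, rfl⟩
    obtain ⟨g, hg⟩ := exists_incl_eq p (muEq p ν) hj
    have h : kernelEq p n ν j = jetEvalOne p n g := by
      rw [jetEvalOne, AlgHom.comp_apply, hg, polyIncl_muEq, kernelEq]
    rw [SetLike.mem_coe, Ideal.mem_comap, RingHom.mem_ker, h, ← complMap_algebraMap,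
      toKernelRing_complMap_jetEvalOne, toKernel, RingHom.comp_apply]
    have h1 : algebraMap (JetPoly p n) _ g ∈ jetIdeal p (muEq p ν) n :=
      Ideal.subset_span ⟨g, ⟨j, hj, hg⟩, rfl⟩
    rw [Ideal.Quotient.eq_zero_iff_mem.2 h1, map_zero]

/-- The triangular system of `phiEq_succ_sub_mem` is solved for one variable at a time, at the cost
of a larger power of `p`. -/
theorem exists_pow_mul_X_mem {N : ℕ} (I : Ideal (MvPolynomial (Fin n) (BaseRing p)))
    (hI : ∀ j ≤ n, p ^ N * (phiEq p n j - 1) ∈ I) :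
    ∃ M : ℕ, ∀ f ∈ Ideal.span (Set.range MvPolynomial.X),
      (p : MvPolynomial (Fin n) (BaseRing p)) ^ M * f ∈ I := by
  have h : ∀ j ≤ n, ∃ M : ℕ,
      ∀ f ∈ Ideal.span {g | ∃ i < j, g = evalOne p n (MvPolynomial.X (i + 1))},
      (p : MvPolynomial (Fin n) (BaseRing p)) ^ M * f ∈ I := by
    intro j hj
    induction j with
    | zero => exact ⟨0, fun f hf => by simp_all⟩
    | succ j ih =>
      obtain ⟨M, hM⟩ := ih (by lia)
      set B := MvPolynomial (Fin n) (BaseRing p)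
      have h1 : (p : B) ^ (M + N + (j + 1)) * evalOne p n (MvPolynomial.X (j + 1)) ∈ I := by
        -- The factor `p^N` brings `φ^{j+1}(x) - 1` into `I`, `p^M` brings in its part in the
        -- earlier variables, and `p^{j+1}` is the coefficient of `x^{(j+1)}`.
        have h2 := Ideal.mul_mem_left I ((p : B) ^ M) (hI (j + 1) hj)
        have h3 := Ideal.mul_mem_left I ((p : B) ^ N) (hM _ (phiEq_succ_sub_mem p j))
        convert sub_mem h2 h3 using 1
        ring
      refine ⟨M + N + (j + 1), fun f hf => ?_⟩
      induction hf using Submodule.span_induction with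
      | mem x hx =>
        obtain ⟨i, hi, rfl⟩ := hx
        rcases Nat.lt_succ_iff_lt_or_eq.1 hi with hi | rfl
        · have h2 := hM _ (Ideal.subset_span ⟨i, hi, rfl⟩)
          rw [add_assoc, add_comm, pow_add, mul_assoc]
          exact Ideal.mul_mem_left _ _ h2
        · exact h1
      | zero => simp
      | add x y _ _ hx hy => rw [mul_add]; exact add_mem hx hy
      | smul a x _ hx => rw [smul_eq_mul, mul_left_comm]; exact Ideal.mul_mem_left _ _ hx
  obtain ⟨M, hM⟩ := h n le_rfl
  refine ⟨M, fun f hf => hM f (Ideal.span_mono ?_ hf)⟩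
  rintro _ ⟨i, rfl⟩
  exact ⟨i, i.2, (evalOne_X_succ p i).symm⟩

/-- The ideal `(x', …, x^{(n)})` of the completion of `R[x', …, x^{(n)}]`. -/
abbrev augIdeal (n : ℕ) : Ideal (PCompl p (MvPolynomial (Fin n) (BaseRing p))) :=
  Ideal.span (Set.range fun i => algebraMap (MvPolynomial (Fin n) (BaseRing p)) _ (MvPolynomial.X i))

theorem augIdeal_eq_map : augIdeal p n = (Ideal.span (Set.range MvPolynomial.X)).map
    (algebraMap (MvPolynomial (Fin n) (BaseRing p)) _) := by
  rw [Ideal.map_span, ← Set.range_comp]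
  rfl

theorem exists_pow_mul_mem_ker (hp : p ≠ 2) (ν : ℕ) :
    ∃ N : ℕ, ∀ y ∈ augIdeal p n, p ^ N * y ∈ RingHom.ker (toKernelRing p n ν) := by
  set B := MvPolynomial (Fin n) (BaseRing p)
  set I := RingHom.ker (toKernelRing p n ν) with hI
  have h : ∀ j ≤ n, (p : B) ^ ν * (phiEq p n j - 1) ∈ I.comap (algebraMap B (PCompl p B)) := by
    intro j hj
    obtain ⟨t, ht⟩ := dvd_phiEq_sub_one p (n := n) j
    obtain ⟨w, hw⟩ := one_add_pow_prime_pow ((Fact.out : p.Prime).odd_of_ne_two hp) t ν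
    have h1 : phiEq p n j ^ p ^ ν - 1 ∈ kernelEqIdeal p n ν := by
      have h2 : Ideal.span {g | ∃ i < j, g = kernelEq p n ν i} ≤ kernelEqIdeal p n ν := by
        refine Ideal.span_mono ?_
        rintro _ ⟨i, hi, rfl⟩
        exact ⟨i, by lia, rfl⟩
      have h3 : kernelEq p n ν j ∈ kernelEqIdeal p n ν := Ideal.subset_span ⟨j, hj, rfl⟩
      simpa using add_mem (h2 (phiEq_pow_sub_mem p ν j)) (Ideal.mul_mem_left _ ((p : B) ^ j) h3)
    rw [← ht, add_comm, ← sub_eq_iff_eq_add.1 (rfl : phiEq p n j - 1 = _)] at hw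
    -- The factor `1 + p w` becomes a unit in the completion, so it is cancelled there.
    have h4 := Ideal.mem_map_of_mem (algebraMap B (PCompl p B)) (hw ▸ h1)
    rw [← ker_toKernelRing, ← hI, map_mul, map_add (algebraMap B (PCompl p B)), map_one,
      map_mul _ (p : B) w, map_natCast] at h4
    exact (Ideal.mul_unit_mem_iff_mem _ (PCompl.isUnit_one_add _)).1 h4
  obtain ⟨M, hM⟩ := exists_pow_mul_X_mem p _ h
  refine ⟨M, fun y hy => ?_⟩
  rw [augIdeal_eq_map] at hy
  induction hy using Submodule.span_induction with
  | mem x hx =>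
    obtain ⟨f, hf, rfl⟩ := hx
    have := hM f hf
    rwa [Ideal.mem_comap, map_mul, map_pow, map_natCast] at this
  | zero => simp
  | add x y _ _ hx hy => rw [mul_add]; exact add_mem hx hy
  | smul a x _ hx => rw [smul_eq_mul, mul_left_comm]; exact Ideal.mul_mem_left _ _ hx

theorem exists_ker_le_pow_mul (M : ℕ) : ∃ K : ℕ+, ∀ k ≥ K,
    ∀ z ∈ RingHom.ker (toKernelRing p n k), ∃ y ∈ augIdeal p n, z = p ^ M * y := by
  choose K hK using fun j => exists_pow_dvd_kernelEq p (n := n) j M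
  refine ⟨⟨(Finset.range (n + 1)).sup K + 1, Nat.succ_pos _⟩, fun k hk z hz => ?_⟩
  have hk' : (Finset.range (n + 1)).sup K + 1 ≤ (k : ℕ) := hk
  rw [ker_toKernelRing] at hz
  have hle : kernelEqIdeal p n k
      ≤ Ideal.span {(p : MvPolynomial (Fin n) (BaseRing p)) ^ M}
        * Ideal.span (Set.range MvPolynomial.X) := by
    rw [kernelEqIdeal, Ideal.span_le]
    rintro _ ⟨j, hj, rfl⟩
    have hjK := Finset.le_sup (f := K) (Finset.mem_range.2 (Nat.lt_succ_of_le hj))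
    obtain ⟨y, hy⟩ := hK j k (by lia)
    -- The quotient by `p^M` still has zero constant term because `p^M` is nonzero in the domain
    -- `R`.
    refine Ideal.mem_span_singleton_mul.2 ⟨y, (mem_span_X_iff p y).2 ?_, hy.symm⟩
    have h0 := constantCoeff_kernelEq p (n := n) k j
    rw [hy, map_mul, map_pow, map_natCast] at h0
    exact (mul_eq_zero.1 h0).resolve_left (pow_ne_zero _ (p_ne_zero_base p))
  have h1 := Ideal.map_mono hle hz
  rw [Ideal.map_mul, ← augIdeal_eq_map, Ideal.map_span, Set.image_singleton, map_pow, map_natCast,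
    Ideal.mem_span_singleton_mul] at h1
  obtain ⟨y, hy, rfl⟩ := h1
  exact ⟨y, hy, rfl⟩

end KernelRing

end PJet

end

/-! ### Passage to the inverse limit -/

theorem proposition5p4 (p : ℕ) [Fact p.Prime] (hp : p ≠ 2) (n : ℕ) (hn : 1 ≤ n) :
    Function.Bijective (PJet.toMuLimit p n) := by
  open PJet in
  constructor
  · rw [injective_iff_map_eq_zero]
    intro a ha
    refine PCompl.eq_zero_of_forall_pow_dvd fun M => ?_
    obtain ⟨K, hK⟩ := exists_ker_le_pow_mul p (n := n) M
    -- A single component of the limit, at a level `K` depending on `M`, already forces divisibility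
    -- by `p^M`.
    obtain ⟨y, -, hy⟩ := hK K le_rfl a (congrFun (congrArg Subtype.val ha) K)
    exact ⟨y, hy⟩
  · rintro ⟨c, hc⟩
    choose a ha using fun ν : ℕ+ => toKernelRing_surjective p (n := n) ν (c ν)
    obtain ⟨b, hb⟩ := PCompl.exists_lift
      (fun i => algebraMap (MvPolynomial (Fin n) (BaseRing p)) _ (MvPolynomial.X i))
      (fun ν : ℕ+ => RingHom.ker (toKernelRing p n ν))
      (fun ν => exists_pow_mul_mem_ker p hp ν) (fun M => exists_ker_le_pow_mul p M) a (by
        intro ν k hνk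
        rw [RingHom.mem_ker, map_sub, ha, sub_eq_zero, ← hc ν k ((PNat.coe_le_coe _ _).2 hνk), ← ha,
          kernelRes_toKernelRing])
    refine ⟨b, Subtype.ext (funext fun ν => ?_)⟩
    have h := hb ν
    rw [RingHom.mem_ker, map_sub, ha, sub_eq_zero] at h
    exact h
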